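/- All graphs are finite and simple; $\Delta(G)$ is the maximum degree of $G$ and $\ell(G)$ its line graph. Let $A$ be an Abelian group (finite or infinite), $L$ an assignment of a finite list $L(v)\subseteq A$ to each vertex $v$ of a graph $G$, and fix an orientation of $G$. For $f:E(G)\to A$, an $(A,L,f)$-coloring of $G$ is a map $c:V(G)\to A$ with $c(v)\in L(v)$ for every vertex $v$ and $c(x)-c(y)\neq f(xy)$ for every edge $xy$ directed from $x$ to $y$. The graph $G$ is $(A,L)$-colorable if it has an $(A,L,f)$-coloring for every $f:E(G)\to A$ (this does not depend on the orientation). It is $k$-group choosable if it is $(A,L)$-colorable for every Abelian group $A$ of order at least $k$ and every $L$ with $|L(v)|=k$ for all $v$; $\chi_{gl}(G)$ is the least such $k$. $G$ is edge-$k$-group choosable if $\ell(G)$ is $k$-group choosable, and $\chi'_{gl}(G)=\chi_{gl}(\ell(G))$. Let $\overline{K_2}+(K_1\cup K_2)$ be the join of the edgeless graph on two vertices with the disjoint union of $K_1$ and $K_2$ (equivalently, $K_{2,3}$ plus an edge joining two vertices of degree $2$). **Theorem.** If $G$ has no minor isomorphic to $\overline{K_2}+(K_1\cup K_2)$, then $\chi'_{gl}(G)\le\Delta(G)+1$.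 In particular, every graph $G$ with no $K_{2,3}$ minor is edge-$(\Delta(G)+1)$-group choosable. -/

import Mathlib

universe u v w

namespace GroupChoosability

/-- `D` is an orientation of `G`: every edge of `G` is directed in exactly one of its two
directions, and nothing else is directed. `D x y` reads: the edge `xy` is directed from
`x` to `y`. -/
structure IsOrientation {V : Type u} (G : SimpleGraph V) (D : V → V → Prop) : Prop where
  adj : ∀ {x y : V}, D x y → G.Adj x y
  directed : ∀ {x y : V}, G.Adj x y → D x y ∨ D y x
  asymm : ∀ {x y : V}, D x y → ¬ D y x

/-- `c` is an `(A, L, f)`-coloring of `G` under the orientation `D`: `c v ∈ L v` for every vertex,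
and `c x - c y ≠ f (xy)` for every edge `xy` directed from `x` to `y`. -/
def IsGroupListColoring {V : Type u} {A : Type w} [AddCommGroup A] (G : SimpleGraph V)
    {D : V → V → Prop} (hD : IsOrientation G D) (L : V → Finset A) (f : G.edgeSet → A)
    (c : V → A) : Prop :=
  (∀ v, c v ∈ L v) ∧
    ∀ (x y : V) (h : D x y), c x - c y ≠ f ⟨s(x, y), G.mem_edgeSet.2 (hD.adj h)⟩

/-- `G` is `(A, L)`-colorable: under every orientation and for every `f : E(G) → A` there is an
`(A, L, f)`-coloring. (Reversing an edge and negating `f` on it changes nothing, so the choice of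
orientation is immaterial.) -/
def IsGroupListColorable {V : Type u} {A : Type w} [AddCommGroup A] (G : SimpleGraph V)
    (L : V → Finset A) : Prop :=
  ∀ (D : V → V → Prop) (hD : IsOrientation G D) (f : G.edgeSet → A),
    ∃ c : V → A, IsGroupListColoring G hD L f c

/-- `G` is `k`-group choosable: it is `(A, L)`-colorable for every Abelian group `A` (finite or
infinite) of order at least `k` and every `k`-list assignment `L`. -/
def IsGroupChoosable {V : Type u} (G : SimpleGraph V) (k : ℕ) : Prop :=
  ∀ (A : Type w) [AddCommGroup A], (k : ℕ∞) ≤ ENat.card A →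
    ∀ L : V → Finset A, (∀ v, (L v).card = k) → IsGroupListColorable G L

/-- The group choice number `χ_gl(G)`: the least `k` such that `G` is `k`-group choosable
(`⊤` if there is none). -/
noncomputable def groupChoiceNumber {V : Type u} (G : SimpleGraph V) : ℕ∞ :=
  ⨅ k ∈ {k : ℕ | IsGroupChoosable.{u, w} G k}, (k : ℕ∞)

/-- `G` is edge-`k`-group choosable: its line graph is `k`-group choosable. -/
def IsEdgeGroupChoosable {V : Type u} (G : SimpleGraph V) (k : ℕ) : Prop :=
  IsGroupChoosable.{u, w} G.lineGraph k

/-- The group-choice index `χ'_gl(G) = χ_gl(ℓ(G))`. -/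
noncomputable def groupChoiceIndex {V : Type u} (G : SimpleGraph V) : ℕ∞ :=
  groupChoiceNumber.{u, w} G.lineGraph

/-- `H` is a minor of `G`: there are pairwise disjoint connected (hence nonempty) branch sets in
`G`, one for each vertex of `H`, such that the branch sets of adjacent vertices of `H` are joined
by an edge of `G`. -/
def IsMinor {W : Type v} {V : Type u} (H : SimpleGraph W) (G : SimpleGraph V) : Prop :=
  ∃ B : W → Set V,
    (∀ a, (G.induce (B a)).Connected) ∧
    (∀ a b, a ≠ b → Disjoint (B a) (B b)) ∧
    ∀ a b, H.Adj a b → ∃ x ∈ B a, ∃ y ∈ B b, G.Adj x y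

/-- The join `G + H`: the disjoint union of `G` and `H` together with all edges between them. -/
def graphJoin {V : Type u} {W : Type v} (G : SimpleGraph V) (H : SimpleGraph W) :
    SimpleGraph (V ⊕ W) :=
  (G ⊕g H) ⊔ completeBipartiteGraph V W

/-- The graph `K̄₂ + (K₁ ∪ K₂)`, where `K̄₂` is the edgeless graph on two vertices: `K_{2,3}`
with an edge added between two vertices of degree `2`. -/
def nearOuterplanarObstruction : SimpleGraph (Fin 2 ⊕ (Fin 1 ⊕ Fin 2)) :=
  graphJoin (⊥ : SimpleGraph (Fin 2)) ((⊤ : SimpleGraph (Fin 1)) ⊕g (⊤ : SimpleGraph (Fin 2)))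

end GroupChoosability

/-! Edges are colored by strong induction on the set `S` of edges to be colored. Suppose that, in
the spanning subgraph with edge set `S`, some nonisolated vertex `v` has degree at most two. Then an
edge `vw` of `S` meets at most 1 + (Δ - 1) other edges of `S`, so a list of Δ + 1 colors leaves one
free.

Otherwise every nonisolated vertex has degree at least three, and excluding the minor forces a K₄ on
`a b c d` in which `a` and `b` have no further neighbors along `S`
(`exists_complete_four_of_not_isMinor`). The source of this K₄ is a longest path whose first end has
a shortest possible chord. The edge `ab` meets only four other edges of `S`, which suffices if Δ ≥
4. If Δ = 3, the K₄ is a component of `G`, and its line graph is the octahedron, which is 4-group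
choosable (`IsColoringOn.exists_insert_octahedron`). -/

namespace GroupChoosability

open Finset

/-! ### Partial group colorings and the octahedron -/

section Coloring

variable {X : Type*} {A : Type*} [AddCommGroup A]

/-- `c` colors the vertices of `S` from their lists, and no edge `xy` of `Γ` inside `S` satisfies
`c x - c y = g x y`. -/
def IsColoringOn (Γ : SimpleGraph X) (g : X → X → A) (L : X → Finset A) (S : Finset X)
    (c : X → A) : Prop :=
  ∀ x ∈ S, c x ∈ L x ∧ ∀ y ∈ S, Γ.Adj x y → c x - c y ≠ g x y

variable {Γ : SimpleGraph X} {g : X → X → A} {L : X → Finset A} {S : Finset X} {c : X → A}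

theorem IsColoringOn.exists_insert_of_mem [DecidableEq X] (hg : ∀ x y, g y x = -g x y)
    (hc : IsColoringOn Γ g L S c) {v : X} (hv : v ∉ S) {z : A} (hz : z ∈ L v)
    (h : ∀ u ∈ S, Γ.Adj v u → z ≠ g v u + c u) :
    ∃ c', IsColoringOn Γ g L (insert v S) c' ∧ c' v = z ∧ ∀ u ∈ S, c' u = c u := by
  have hne : ∀ u ∈ S, Function.update c v z u = c u := fun u hu =>
    Function.update_of_ne (ne_of_mem_of_not_mem hu hv) _ _
  refine ⟨Function.update c v z, ?_, Function.update_self .., hne⟩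
  intro x hx'
  rcases mem_insert.1 hx' with rfl | hx
  · refine ⟨by simpa using hz, fun y hy hxy => ?_⟩
    rcases mem_insert.1 hy with rfl | hy
    · exact absurd hxy (Γ.loopless.irrefl _)
    · rw [Function.update_self, hne y hy]
      exact fun e => h y hy hxy (sub_eq_iff_eq_add.1 e)
  · rw [hne x hx]
    refine ⟨(hc x hx).1, fun y hy hxy => ?_⟩
    rcases mem_insert.1 hy with rfl | hy
    · rw [Function.update_self]
      intro e
      apply h x hx hxy.symm
      rw [hg x y, ← e]
      abel
    · rw [hne y hy]
      exact (hc x hx).2 y hy hxy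

/-- A vertex `v` can be colored if its colored neighbors forbid fewer than `|L v|` colors of its
list, as witnessed by a set `T` of representatives. -/
theorem IsColoringOn.exists_insert [DecidableEq X] (hg : ∀ x y, g y x = -g x y)
    (hc : IsColoringOn Γ g L S c) {v : X} (hv : v ∉ S) (T : Finset X) (hT : T.card < (L v).card)
    (h : ∀ u ∈ S, Γ.Adj v u → u ∈ T ∨ g v u + c u ∉ L v ∨ ∃ t ∈ T, g v u + c u = g v t + c t) :
    ∃ c', IsColoringOn Γ g L (insert v S) c' ∧ ∀ u ∈ S, c' u = c u := by
  classical
  obtain ⟨z, hz, hzT⟩ := exists_mem_notMem_of_card_lt_card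
    (lt_of_le_of_lt (card_image_le (s := T) (f := fun t => g v t + c t)) hT)
  obtain ⟨c', h1, -, h2⟩ := hc.exists_insert_of_mem hg hv hz (fun u hu huv e => by
    rcases h u hu huv with h | h | ⟨t, ht, h⟩
    · exact hzT (mem_image.2 ⟨u, h, e.symm⟩)
    · exact h (e ▸ hz)
    · exact hzT (mem_image.2 ⟨t, ht, (e.trans h).symm⟩))
  exact ⟨c', h1, h2⟩

/-- Translation preserves cardinality, so `s + P` inside `R` means `s + P = R`, and then any `t + y`
in `R` is already some `s + x`. In every outcome the two chosen colors together forbid at most one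
element of `R`. -/
theorem exists_colors_with_common_conflict [DecidableEq A] {P Q R : Finset A} (s t : A)
    (hR : R.Nonempty) (hP : P.card = R.card) (hQ : Q.card = R.card) :
    ∃ x ∈ P, ∃ y ∈ Q, s + x ∉ R ∨ t + y ∉ R ∨ t + y = s + x := by
  by_cases h : ∃ x ∈ P, s + x ∉ R
  · obtain ⟨x, hx, h⟩ := h
    obtain ⟨y, hy⟩ : Q.Nonempty := card_pos.1 (hQ ▸ hR.card_pos)
    exact ⟨x, hx, y, hy, Or.inl h⟩
  · push Not at h
    have himg : P.image (s + ·) = R := by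
      apply eq_of_subset_of_card_le
      · intro z hz
        obtain ⟨x, hx, rfl⟩ := mem_image.1 hz
        exact h x hx
      · rw [card_image_of_injective _ (add_right_injective s), hP]
    obtain ⟨y, hy⟩ : Q.Nonempty := card_pos.1 (hQ ▸ hR.card_pos)
    by_cases hyR : t + y ∈ R
    · rw [← himg] at hyR
      obtain ⟨x, hx, e⟩ := mem_image.1 hyR
      exact ⟨x, hx, y, hy, Or.inr (Or.inr e.symm)⟩
    · obtain ⟨x, hx⟩ : P.Nonempty := card_pos.1 (hP ▸ hR.card_pos)
      exact ⟨x, hx, y, hy, Or.inr (Or.inl hyR)⟩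

/-- The octahedron, with antipodal pairs `a b`, `c d`, `e f`, is `4`-group choosable. -/
theorem IsColoringOn.exists_insert_octahedron [DecidableEq X] (hg : ∀ x y, g y x = -g x y)
    {φ : X → A} (hφ : IsColoringOn Γ g L S φ) (hL : ∀ x, (L x).card = 4) {a b c d e f : X}
    (hnd : [c, f, e, d, b, a].Nodup) (hab : ¬ Γ.Adj b a) (hcd : ¬ Γ.Adj c d) (hef : ¬ Γ.Adj f e)
    (hS : ∀ x ∈ [c, f, e, d, b, a], x ∉ S ∧ ∀ u ∈ S, ¬ Γ.Adj x u) :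
    ∃ ψ, IsColoringOn Γ g L (insert c (insert f (insert e (insert d (insert b (insert a S)))))) ψ := by
  classical
  simp only [List.nodup_cons, List.mem_cons, List.not_mem_nil, or_false, not_or, not_false_eq_true,
    List.nodup_nil, and_true] at hnd
  obtain ⟨⟨hc1, hc2, hc3, hc4, hc5⟩, ⟨hf1, hf2, hf3, hf4⟩, ⟨he1, he2, he3⟩, ⟨hd1, hd2⟩, hb1⟩ := hnd
  simp only [List.mem_cons, List.not_mem_nil, or_false, forall_eq_or_imp, forall_eq] at hS
  obtain ⟨⟨hcS, hcA⟩, ⟨hfS, hfA⟩, ⟨heS, heA⟩, ⟨hdS, hdA⟩, ⟨hbS, hbA⟩, ⟨haS, haA⟩⟩ := hS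
  -- The antipodal pair `a`, `b` is colored so as to cost `c` at most one color. In the order `d`,
  -- `e`, `f`, `c`, every vertex then loses at most three of its four colors.
  obtain ⟨x, hx, y, hy, hxy⟩ := exists_colors_with_common_conflict (P := L a) (Q := L b) (R := L c)
    (g c a) (g c b) (card_pos.1 (by simp [hL])) (by simp [hL]) (by simp [hL])
  obtain ⟨φ₁, h₁, h₁a, -⟩ := hφ.exists_insert_of_mem hg haS hx
    (fun u hu h => absurd h (haA u hu))
  obtain ⟨φ₂, h₂, h₂b, h₂'⟩ := h₁.exists_insert_of_mem hg (v := b) (by simp [*]) hy (by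
    intro u hu h
    rcases mem_insert.1 hu with rfl | hu
    · exact absurd h hab
    · exact absurd h (hbA u hu))
  have h₂a : φ₂ a = x := (h₂' a (by simp)).trans h₁a
  obtain ⟨φ₃, h₃, h₃'⟩ := h₂.exists_insert hg (v := d) (by simp [*]) {a, b}
    (by rw [hL]; exact card_le_two.trans_lt (by norm_num)) (by
    intro u hu h
    simp only [mem_insert] at hu
    rcases hu with rfl | rfl | hu
    · simp
    · simp
    · exact absurd h (hdA u hu))
  obtain ⟨φ₄, h₄, h₄'⟩ := h₃.exists_insert hg (v := e) (by simp [*]) {a, b, d}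
    (by rw [hL]; exact card_le_three.trans_lt (by norm_num)) (by
    intro u hu h
    simp only [mem_insert] at hu
    rcases hu with rfl | rfl | rfl | hu
    · simp
    · simp
    · simp
    · exact absurd h (heA u hu))
  obtain ⟨φ₅, h₅, h₅'⟩ := h₄.exists_insert hg (v := f) (by simp [*]) {a, b, d}
    (by rw [hL]; exact card_le_three.trans_lt (by norm_num)) (by
    intro u hu h
    simp only [mem_insert] at hu
    rcases hu with rfl | rfl | rfl | rfl | hu
    · exact absurd h hef
    · simp
    · simp
    · simp
    · exact absurd h (hfA u hu))
  have h₅a : φ₅ a = x := by rw [h₅' a (by simp), h₄' a (by simp), h₃' a (by simp), h₂a]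
  have h₅b : φ₅ b = y := by rw [h₅' b (by simp), h₄' b (by simp), h₃' b (by simp), h₂b]
  -- `r` is whichever of `a`, `b` represents both conflicts at `c`.
  have hlast : ∃ r, ∀ u ∈ ({a, b} : Finset X),
      u = r ∨ g c u + φ₅ u ∉ L c ∨ g c u + φ₅ u = g c r + φ₅ r := by
    rcases hxy with h | h | h
    · exact ⟨b, by simp [h₅a, h₅b, h]⟩
    · exact ⟨a, by simp [h₅a, h₅b, h]⟩
    · exact ⟨a, by simp [h₅a, h₅b, h]⟩
  obtain ⟨r, hr⟩ := hlast
  have hr' : ∀ u ∈ ({a, b} : Finset X), u ∈ ({r, e, f} : Finset X) ∨ g c u + φ₅ u ∉ L c ∨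
      ∃ t ∈ ({r, e, f} : Finset X), g c u + φ₅ u = g c t + φ₅ t := by
    intro u hu
    rcases hr u hu with h | h | h
    · exact Or.inl (by simp [h])
    · exact Or.inr (Or.inl h)
    · exact Or.inr (Or.inr ⟨r, by simp, h⟩)
  obtain ⟨φ₆, h₆, -⟩ := h₅.exists_insert hg (v := c) (by simp [*]) {r, e, f}
    (by rw [hL]; exact card_le_three.trans_lt (by norm_num)) (by
    intro u hu h
    simp only [mem_insert] at hu
    rcases hu with rfl | rfl | rfl | rfl | rfl | hu
    · simp
    · simp
    · exact absurd h hcd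
    · exact hr' _ (by simp)
    · exact hr' _ (by simp)
    · exact absurd h (hcA u hu))
  exact ⟨φ₆, h₆⟩

end Coloring

theorem IsColoringOn.mono {X A : Type*} [AddCommGroup A] {Γ : SimpleGraph X} {g : X → X → A}
    {L : X → Finset A} {S T : Finset X} {c : X → A} (h : IsColoringOn Γ g L T c) (hST : S ⊆ T) :
    IsColoringOn Γ g L S c :=
  fun x hx => ⟨(h x (hST hx)).1, fun y hy => (h x (hST hx)).2 y (hST hy)⟩

/-! ### Minors from paths with chords -/

section Minors

variable {V : Type*} {G : SimpleGraph V}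

theorem IsMinor.mono {W : Type*} {K : SimpleGraph W} {H : SimpleGraph V} (hHG : H ≤ G)
    (h : IsMinor K H) : IsMinor K G := by
  obtain ⟨B, h1, h2, h3⟩ := h
  refine ⟨B, fun a => (h1 a).mono fun _ _ h => hHG h, h2, fun a b hab => ?_⟩
  obtain ⟨x, hx, y, hy, hxy⟩ := h3 a b hab
  exact ⟨x, hx, y, hy, hHG hxy⟩

theorem IsMinor.of_injective_hom {W W' : Type*} {K : SimpleGraph W} {K' : SimpleGraph W'}
    (φ : K' →g K) (hφ : Function.Injective φ) (h : IsMinor K G) : IsMinor K' G := by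
  obtain ⟨B, h1, h2, h3⟩ := h
  exact ⟨B ∘ φ, fun a => h1 _, fun a b hab => h2 _ _ (hφ.ne hab), fun a b hab => h3 _ _ (φ.map_adj hab)⟩

/-- K₂,₃ is a spanning subgraph of the obstruction, so the same branch sets serve. -/
theorem isMinor_completeBipartiteGraph_of_isMinor_obstruction
    (h : IsMinor nearOuterplanarObstruction G) :
    IsMinor (completeBipartiteGraph (Fin 2) (Fin 3)) G := by
  refine h.of_injective_hom (φ := ⟨Sum.map id (finSumFinEquiv (m := 1) (n := 2)).symm, ?_⟩) ?_
  · rintro (a | a) (b | b) hab <;>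
      simp_all [nearOuterplanarObstruction, graphJoin]
  · exact Function.Injective.sumMap Function.injective_id (Equiv.injective _)

/-- `p 0, …, p m` is a path of `G`. -/
structure IsPathSeq (G : SimpleGraph V) (p : ℕ → V) (m : ℕ) : Prop where
  inj : ∀ {a b : ℕ}, a ≤ m → b ≤ m → p a = p b → a = b
  adj : ∀ {a : ℕ}, a < m → G.Adj (p a) (p (a + 1))

variable {p : ℕ → V} {m : ℕ}

theorem IsPathSeq.connected_interval (hp : IsPathSeq G p m) {a b : ℕ} (hab : a ≤ b) (hb : b ≤ m) :
    (G.induce (p '' Set.Icc a b)).Connected := by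
  rw [SimpleGraph.connected_iff_exists_forall_reachable]
  refine ⟨⟨p a, a, ⟨le_rfl, hab⟩, rfl⟩, ?_⟩
  rintro ⟨_, t, ⟨hat, htb⟩, rfl⟩
  induction t, hat using Nat.le_induction with
  | base => exact SimpleGraph.Reachable.refl _
  | succ t hat ih =>
    refine (ih (by omega)).trans (SimpleGraph.Adj.reachable ?_)
    exact hp.adj (by omega)

/-- Consecutive-interval branch sets on a path yield the obstruction as a minor. -/
theorem IsPathSeq.isMinor_obstruction (hp : IsPathSeq G p m) (la ha lb hb lc hc ld hd le he : ℕ)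
    (hle : la ≤ ha ∧ lb ≤ hb ∧ lc ≤ hc ∧ ld ≤ hd ∧ le ≤ he)
    (hm : ha ≤ m ∧ hb ≤ m ∧ hc ≤ m ∧ hd ≤ m ∧ he ≤ m)
    (hdisj : (ha < lb ∨ hb < la) ∧ (ha < lc ∨ hc < la) ∧ (ha < ld ∨ hd < la) ∧ (ha < le ∨ he < la) ∧
      (hb < lc ∨ hc < lb) ∧ (hb < ld ∨ hd < lb) ∧ (hb < le ∨ he < lb) ∧
      (hc < ld ∨ hd < lc) ∧ (hc < le ∨ he < lc) ∧ (hd < le ∨ he < ld))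
    (hac : ∃ x ∈ Set.Icc la ha, ∃ y ∈ Set.Icc lc hc, G.Adj (p x) (p y))
    (had : ∃ x ∈ Set.Icc la ha, ∃ y ∈ Set.Icc ld hd, G.Adj (p x) (p y))
    (hae : ∃ x ∈ Set.Icc la ha, ∃ y ∈ Set.Icc le he, G.Adj (p x) (p y))
    (hbc : ∃ x ∈ Set.Icc lb hb, ∃ y ∈ Set.Icc lc hc, G.Adj (p x) (p y))
    (hbd : ∃ x ∈ Set.Icc lb hb, ∃ y ∈ Set.Icc ld hd, G.Adj (p x) (p y))
    (hbe : ∃ x ∈ Set.Icc lb hb, ∃ y ∈ Set.Icc le he, G.Adj (p x) (p y))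
    (hde : ∃ x ∈ Set.Icc ld hd, ∃ y ∈ Set.Icc le he, G.Adj (p x) (p y)) :
    IsMinor nearOuterplanarObstruction G := by
  have hsymm : ∀ {I J : Set ℕ}, (∃ x ∈ I, ∃ y ∈ J, G.Adj (p x) (p y)) →
      ∃ x ∈ J, ∃ y ∈ I, G.Adj (p x) (p y) := by
    rintro I J ⟨x, hx, y, hy, h⟩
    exact ⟨y, hy, x, hx, h.symm⟩
  have hda := hsymm had
  have hea := hsymm hae
  have hca := hsymm hac
  have hcb := hsymm hbc
  have hdb := hsymm hbd
  have heb := hsymm hbe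
  have hed := hsymm hde
  let lo : Fin 2 ⊕ (Fin 1 ⊕ Fin 2) → ℕ := Sum.elim ![la, lb] (Sum.elim ![lc] ![ld, le])
  let hi : Fin 2 ⊕ (Fin 1 ⊕ Fin 2) → ℕ := Sum.elim ![ha, hb] (Sum.elim ![hc] ![hd, he])
  have hlohi : ∀ w, lo w ≤ hi w ∧ hi w ≤ m := by
    rintro (x | x | x) <;> fin_cases x <;> simp [lo, hi] <;> omega
  have hsep : ∀ w w', w ≠ w' → hi w < lo w' ∨ hi w' < lo w := by
    rintro (x | x | x) (y | y | y) <;> fin_cases x <;> fin_cases y <;> simp [lo, hi] <;> omega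
  have hadj : ∀ w w', nearOuterplanarObstruction.Adj w w' →
      ∃ x ∈ Set.Icc (lo w) (hi w), ∃ y ∈ Set.Icc (lo w') (hi w'), G.Adj (p x) (p y) := by
    rintro (x | x | x) (y | y | y) h <;> fin_cases x <;> fin_cases y <;>
      first
      | assumption
      | (exfalso; revert h; simp [nearOuterplanarObstruction, graphJoin])
  refine ⟨fun w => p '' Set.Icc (lo w) (hi w),
    fun w => hp.connected_interval (hlohi w).1 (hlohi w).2, fun w w' hw => ?_, fun w w' hw => ?_⟩
  · rw [Set.disjoint_left]
    rintro _ ⟨x, ⟨hx1, hx2⟩, rfl⟩ ⟨y, ⟨hy1, hy2⟩, e⟩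
    have h1 := (hlohi w).2
    have h2 := (hlohi w').2
    have h3 := hp.inj (by omega) (by omega) e
    rcases hsep w w' hw with h | h <;> omega
  · obtain ⟨x, hx, y, hy, h⟩ := hadj w w' hw
    exact ⟨p x, ⟨x, hx, rfl⟩, p y, ⟨y, hy, rfl⟩, h⟩

/-- Outside the exceptional triple, which is a K₄ on `p 0, …, p 3`, the path and the three chords
contain the obstruction, with intervals of the path as branch sets. The cases `j < q` and `q < j`
are exchanged by reversing `p 0, …, p (i - 1)`. -/
theorem IsPathSeq.chords_eq (hp : IsPathSeq G p m) (hM : ¬ IsMinor nearOuterplanarObstruction G)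
    {i j q : ℕ} (hi : 2 ≤ i) (hij : i < j) (hiq : i < q) (hj : j ≤ m) (hq : q ≤ m)
    (h0i : G.Adj (p 0) (p i)) (h0j : G.Adj (p 0) (p j)) (hiq' : G.Adj (p (i - 1)) (p q)) :
    i = 2 ∧ j = 3 ∧ q = 3 := by
  have hadj : ∀ a b, b = a + 1 → b ≤ m → G.Adj (p a) (p b) := by
    rintro a b rfl hb
    exact hp.adj hb
  by_contra hne
  apply hM
  rcases lt_trichotomy j q with h | rfl | h
  · exact hp.isMinor_obstruction 1 (i - 1) (i + 1) j (j + 1) q 0 0 i i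
      (by omega) (by omega) (by omega)
      ⟨i - 1, ⟨by omega, by omega⟩, q, ⟨by omega, by omega⟩, hiq'⟩
      ⟨1, ⟨by omega, by omega⟩, 0, ⟨by omega, by omega⟩, (hadj 0 1 rfl (by omega)).symm⟩
      ⟨i - 1, ⟨by omega, by omega⟩, i, ⟨by omega, by omega⟩, hadj _ _ (by omega) (by omega)⟩
      ⟨j, ⟨by omega, by omega⟩, j + 1, ⟨by omega, by omega⟩, hadj _ _ (by omega) (by omega)⟩
      ⟨j, ⟨by omega, by omega⟩, 0, ⟨by omega, by omega⟩, h0j.symm⟩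
      ⟨i + 1, ⟨by omega, by omega⟩, i, ⟨by omega, by omega⟩,
        (hadj i _ (by omega) (by omega)).symm⟩
      ⟨0, ⟨by omega, by omega⟩, i, ⟨by omega, by omega⟩, h0i⟩
  -- If `j = q = i + 1`, then `i = 2` is the exceptional triple, so `[1, i - 2]` is nonempty.
  · by_cases hj' : j = i + 1
    · exact hp.isMinor_obstruction 0 0 (i - 1) (i - 1) 1 (i - 2) i i j j
        (by omega) (by omega) (by omega)
        ⟨0, ⟨by omega, by omega⟩, 1, ⟨by omega, by omega⟩, hadj _ _ (by omega) (by omega)⟩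
        ⟨0, ⟨by omega, by omega⟩, i, ⟨by omega, by omega⟩, h0i⟩
        ⟨0, ⟨by omega, by omega⟩, j, ⟨by omega, by omega⟩, h0j⟩
        ⟨i - 1, ⟨by omega, by omega⟩, i - 2, ⟨by omega, by omega⟩,
          (hadj _ _ (by omega) (by omega)).symm⟩
        ⟨i - 1, ⟨by omega, by omega⟩, i, ⟨by omega, by omega⟩, hadj _ _ (by omega) (by omega)⟩
        ⟨i - 1, ⟨by omega, by omega⟩, j, ⟨by omega, by omega⟩, hiq'⟩
        ⟨i, ⟨by omega, by omega⟩, j, ⟨by omega, by omega⟩, hadj _ _ (by omega) (by omega)⟩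
    · exact hp.isMinor_obstruction i i j j (i + 1) (j - 1) 0 (i - 2) (i - 1) (i - 1)
        (by omega) (by omega) (by omega)
        ⟨i, ⟨by omega, by omega⟩, i + 1, ⟨by omega, by omega⟩, hadj _ _ (by omega) (by omega)⟩
        ⟨i, ⟨by omega, by omega⟩, 0, ⟨by omega, by omega⟩, h0i.symm⟩
        ⟨i, ⟨by omega, by omega⟩, i - 1, ⟨by omega, by omega⟩,
          (hadj _ _ (by omega) (by omega)).symm⟩
        ⟨j, ⟨by omega, by omega⟩, j - 1, ⟨by omega, by omega⟩,
          (hadj _ _ (by omega) (by omega)).symm⟩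
        ⟨j, ⟨by omega, by omega⟩, 0, ⟨by omega, by omega⟩, h0j.symm⟩
        ⟨j, ⟨by omega, by omega⟩, i - 1, ⟨by omega, by omega⟩, hiq'.symm⟩
        ⟨i - 2, ⟨by omega, by omega⟩, i - 1, ⟨by omega, by omega⟩,
          hadj _ _ (by omega) (by omega)⟩
  · exact hp.isMinor_obstruction 0 (i - 2) (i + 1) q (q + 1) j (i - 1) (i - 1) i i
      (by omega) (by omega) (by omega)
      ⟨0, ⟨by omega, by omega⟩, j, ⟨by omega, by omega⟩, h0j⟩
      ⟨i - 2, ⟨by omega, by omega⟩, i - 1, ⟨by omega, by omega⟩, hadj _ _ (by omega) (by omega)⟩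
      ⟨0, ⟨by omega, by omega⟩, i, ⟨by omega, by omega⟩, h0i⟩
      ⟨q, ⟨by omega, by omega⟩, q + 1, ⟨by omega, by omega⟩, hadj _ _ (by omega) (by omega)⟩
      ⟨q, ⟨by omega, by omega⟩, i - 1, ⟨by omega, by omega⟩, hiq'.symm⟩
      ⟨i + 1, ⟨by omega, by omega⟩, i, ⟨by omega, by omega⟩,
        (hadj _ _ (by omega) (by omega)).symm⟩
      ⟨i - 1, ⟨by omega, by omega⟩, i, ⟨by omega, by omega⟩, hadj _ _ (by omega) (by omega)⟩

theorem IsPathSeq.cons (hp : IsPathSeq G p m) {w : V} (hw : G.Adj (p 0) w)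
    (hnew : ∀ t ≤ m, p t ≠ w) : IsPathSeq G (fun t => Nat.casesOn t w p) (m + 1) where
  inj := by
    rintro (_ | a) (_ | b) ha hb h
    · rfl
    · exact absurd h.symm (hnew b (by omega))
    · exact absurd h (hnew a (by omega))
    · rw [hp.inj (by omega) (by omega) h]
  adj := by
    rintro (_ | a) ha
    · exact hw.symm
    · exact hp.adj (by omega)

/-- Reversing the initial segment `p 0, …, p (i - 1)` of a path along the chord `p 0, p i`. -/
theorem IsPathSeq.rotate (hp : IsPathSeq G p m) {i : ℕ} (hi : i ≤ m) (h : G.Adj (p 0) (p i)) :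
    IsPathSeq G (fun t => if t < i then p (i - 1 - t) else p t) m where
  inj := by
    intro a b ha hb hab
    split_ifs at hab <;> have := hp.inj (by omega) (by omega) hab <;> omega
  adj := by
    intro a ha
    rcases lt_trichotomy (a + 1) i with h1 | h1 | h1
    · rw [if_pos (by omega), if_pos h1]
      have := hp.adj (a := i - 1 - (a + 1)) (by omega)
      rw [show i - 1 - (a + 1) + 1 = i - 1 - a by omega] at this
      exact this.symm
    · rw [if_pos (by omega), if_neg (by omega), h1, show i - 1 - a = 0 by omega]
      exact h
    · rw [if_neg (by omega), if_neg (by omega)]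
      exact hp.adj ha

theorem IsPathSeq.lt_card [Fintype V] (hp : IsPathSeq G p m) : m < Fintype.card V := by
  have := Fintype.card_le_of_injective (fun t : Fin (m + 1) => p t)
    (fun a b h => Fin.ext (hp.inj (by omega) (by omega) h))
  simpa using this

/-- A graph without the obstruction as a minor, having an edge and in which every nonisolated
vertex has degree at least three, contains a `K₄` with two vertices of degree three. -/
theorem exists_complete_four_of_not_isMinor [Fintype V]
    (hM : ¬ IsMinor nearOuterplanarObstruction G) {x y : V} (hxy : G.Adj x y)
    (hdeg : ∀ v w, G.Adj v w → ∀ s t, ∃ u, G.Adj v u ∧ u ≠ s ∧ u ≠ t) :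
    ∃ a b c d, (G.Adj a b ∧ G.Adj a c ∧ G.Adj a d ∧ G.Adj b c ∧ G.Adj b d ∧ G.Adj c d) ∧
      (∀ w, G.Adj a w → w = b ∨ w = c ∨ w = d) ∧ ∀ w, G.Adj b w → w = a ∨ w = c ∨ w = d := by
  classical
  -- `m` is the length of a longest path; all neighbors of an end of such a path lie on it.
  obtain ⟨m, ⟨hm1, hm2⟩, hmax⟩ : ∃ m, (1 ≤ m ∧ ∃ p, IsPathSeq G p m) ∧
      ∀ n, m < n → ¬ ∃ p, IsPathSeq G p n := by
    have h1 : ∃ p, IsPathSeq G p 1 := by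
      refine ⟨fun t => if t = 0 then x else y, ?_, ?_⟩
      · intro a b ha hb h
        have hne := hxy.ne
        interval_cases a <;> interval_cases b <;> simp_all
      · intro a ha
        obtain rfl : a = 0 := by omega
        simpa using hxy
    have hb : ∀ n, (∃ p, IsPathSeq G p n) → n ≤ Fintype.card V := fun n ⟨p, hp⟩ => hp.lt_card.le
    refine ⟨Nat.findGreatest (fun n => ∃ p, IsPathSeq G p n) (Fintype.card V),
      ⟨Nat.le_findGreatest (hb 1 h1) h1,
        Nat.findGreatest_spec (P := fun n => ∃ p, IsPathSeq G p n) (hb 1 h1) h1⟩, fun n hn h => ?_⟩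
    exact Nat.findGreatest_is_greatest hn (hb n h) h
  have honpath : ∀ p, IsPathSeq G p m → ∀ w, G.Adj (p 0) w → ∃ t, 1 ≤ t ∧ t ≤ m ∧ p t = w := by
    intro p hp w hw
    by_contra! hcon
    refine hmax (m + 1) (by omega) ⟨_, hp.cons hw fun t ht e => ?_⟩
    rcases Nat.eq_zero_or_pos t with rfl | h0
    · exact hw.ne e
    · exact hcon t h0 ht e
  have hchord : ∀ p, IsPathSeq G p m → ∀ k, ∃ i, 2 ≤ i ∧ i ≤ m ∧ i ≠ k ∧ G.Adj (p 0) (p i) := by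
    intro p hp k
    obtain ⟨u, hu, hu1, hu2⟩ := hdeg (p 0) (p 1) (hp.adj (by omega)) (p 1) (p k)
    obtain ⟨t, ht1, htm, rfl⟩ := honpath p hp u hu
    refine ⟨t, ?_, htm, fun e => hu2 (by rw [e]), hu⟩
    rcases ht1.eq_or_lt with rfl | h
    · exact absurd rfl hu1
    · exact h
  -- `i` is minimized over all longest paths at once, so that minimality also applies to the rotated
  -- path.
  have hex : ∃ i, 2 ≤ i ∧ i ≤ m ∧ ∃ p, IsPathSeq G p m ∧ G.Adj (p 0) (p i) := by
    obtain ⟨p, hp⟩ := hm2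
    obtain ⟨i, h1, h2, -, h3⟩ := hchord p hp 0
    exact ⟨i, h1, h2, p, hp, h3⟩
  have hmin := fun k => Nat.find_min (m := k) hex
  obtain ⟨hi2, him, p, hp, h0i⟩ := Nat.find_spec hex
  generalize Nat.find hex = i at *
  have hbeyond : ∀ p, IsPathSeq G p m → ∀ w, G.Adj (p 0) w →
      w = p 1 ∨ w = p i ∨ ∃ t, i < t ∧ t ≤ m ∧ p t = w := by
    intro p hp w hw
    obtain ⟨t, ht1, htm, rfl⟩ := honpath p hp w hw
    rcases lt_trichotomy t i with h | rfl | h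
    · rcases ht1.eq_or_lt with rfl | h'
      · exact Or.inl rfl
      · exact absurd ⟨h', htm, p, hp, hw⟩ (hmin t h)
    · exact Or.inr (Or.inl rfl)
    · exact Or.inr (Or.inr ⟨t, h, htm, rfl⟩)
  -- The rotated path starts `p (i - 1), p (i - 2)` and agrees with `p` from index `i` on.
  have hbeyond_rot : ∀ w, G.Adj (p (i - 1)) w →
      w = p (i - 2) ∨ w = p i ∨ ∃ t, i < t ∧ t ≤ m ∧ p t = w := by
    intro w hw
    have h := hbeyond _ (hp.rotate him h0i) w (by
      simpa [show 0 < i by omega] using hw)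
    simp only [show 1 < i by omega, lt_irrefl, if_true, if_false] at h
    rcases h with h | h | ⟨t, h1, h2, h3⟩
    · exact Or.inl (by rw [h]; congr 1)
    · exact Or.inr (Or.inl h)
    · rw [if_neg (by omega)] at h3
      exact Or.inr (Or.inr ⟨t, h1, h2, h3⟩)
  obtain ⟨j, hij, hjm, h0j⟩ : ∃ j, i < j ∧ j ≤ m ∧ G.Adj (p 0) (p j) := by
    obtain ⟨u, hu, hu1, hu2⟩ := hdeg _ _ h0i (p 1) (p i)
    rcases hbeyond p hp u hu with h | h | ⟨t, h1, h2, rfl⟩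
    · exact absurd h hu1
    · exact absurd h hu2
    · exact ⟨t, h1, h2, hu⟩
  have hi1 : G.Adj (p (i - 1)) (p i) := by
    have := hp.adj (a := i - 1) (by omega)
    rwa [show i - 1 + 1 = i by omega] at this
  obtain ⟨q, hiq, hqm, h1q⟩ : ∃ q, i < q ∧ q ≤ m ∧ G.Adj (p (i - 1)) (p q) := by
    obtain ⟨u, hu, hu1, hu2⟩ := hdeg _ _ hi1 (p (i - 2)) (p i)
    rcases hbeyond_rot u hu with h | h | ⟨t, h1, h2, rfl⟩
    · exact absurd h hu1
    · exact absurd h hu2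
    · exact ⟨t, h1, h2, hu⟩
  obtain ⟨rfl, rfl, rfl⟩ := hp.chords_eq hM hi2 hij hiq hjm hqm h0i h0j h1q
  refine ⟨p 0, p 1, p 2, p 3, ⟨hp.adj (by omega), h0i, h0j, hi1, h1q, hp.adj (by omega)⟩,
    fun w hw => ?_, fun w hw => ?_⟩
  -- Any further neighbor beyond `p 2` could replace the chosen chord end, so `chords_eq` places it
  -- at `p 3`.
  · rcases hbeyond p hp w hw with h | h | ⟨t, h1, h2, rfl⟩
    · exact Or.inl h
    · exact Or.inr (Or.inl h)
    · rw [(hp.chords_eq hM hi2 h1 hiq h2 hqm h0i hw h1q).2.1]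
      simp
  · rcases hbeyond_rot w hw with h | h | ⟨t, h1, h2, rfl⟩
    · exact Or.inl h
    · exact Or.inr (Or.inl h)
    · rw [(hp.chords_eq hM hi2 hij h1 hjm h2 h0i h0j hw).2.2]
      simp

end Minors

/-! ### Coloring the line graph -/

section EdgeColoring

variable {V : Type*} {G : SimpleGraph V} {A : Type*} [AddCommGroup A]
  {g : G.edgeSet → G.edgeSet → A} {L : G.edgeSet → Finset A} {S : Finset G.edgeSet}

/-- The spanning subgraph of `G` with edge set `S`. -/
def edgeSubgraph (S : Finset G.edgeSet) : SimpleGraph V where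
  Adj u v := ∃ h : G.Adj u v, (⟨s(u, v), h⟩ : G.edgeSet) ∈ S
  symm := ⟨fun u v ⟨h, hS⟩ => ⟨h.symm, by simpa only [Sym2.eq_swap (a := v)] using hS⟩⟩
  loopless := ⟨fun _ ⟨h, _⟩ => G.loopless.irrefl _ h⟩

theorem edgeSubgraph_le : edgeSubgraph S ≤ G := fun _ _ h => h.1

theorem exists_edgeSubgraph_adj {e : G.edgeSet} (he : e ∈ S) {v : V} (hv : v ∈ e.1) :
    ∃ w, (edgeSubgraph S).Adj v w ∧ e.1 = s(v, w) := by
  obtain ⟨e, h⟩ := e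
  obtain ⟨w, rfl⟩ := Sym2.mem_iff_exists.1 hv
  exact ⟨w, ⟨h, he⟩, rfl⟩

theorem exists_isColoringOn_of_erase [DecidableEq G.edgeSet] (hg : ∀ x y, g y x = -g x y)
    {e : G.edgeSet} (he : e ∈ S) (h : ∃ c, IsColoringOn G.lineGraph g L (S.erase e) c)
    (F : Finset (Sym2 V)) (hF : F.card < (L e).card)
    (hadj : ∀ u ∈ S, u ≠ e → ∀ z ∈ e.1, z ∈ u.1 → u.1 ∈ F) :
    ∃ c, IsColoringOn G.lineGraph g L S c := by
  classical
  obtain ⟨c, hc⟩ := h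
  obtain ⟨c', hc', -⟩ := hc.exists_insert hg (notMem_erase e S) (S.filter fun u => u.1 ∈ F)
    (lt_of_le_of_lt (card_le_card_of_injOn Subtype.val (fun u hu => (mem_filter.1 hu).2)
      Subtype.val_injective.injOn) hF) (fun u hu huv => by
        obtain ⟨-, z, hz, hz'⟩ := SimpleGraph.lineGraph_adj_iff_exists.1 huv
        obtain ⟨hne, hu⟩ := mem_erase.1 hu
        exact Or.inl (mem_filter.2 ⟨hu, hadj u hu hne z hz hz'⟩))
  rw [insert_erase he] at hc'
  exact ⟨c', hc'⟩

theorem eq_of_adj_of_degree_le_three [Fintype V] [DecidableRel G.Adj] {v x y z w : V}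
    (hv : G.degree v ≤ 3) (hx : G.Adj v x) (hy : G.Adj v y) (hz : G.Adj v z) (hxy : x ≠ y)
    (hxz : x ≠ z) (hyz : y ≠ z) (hw : G.Adj v w) : w = x ∨ w = y ∨ w = z := by
  classical
  have h : ({x, y, z} : Finset V) = G.neighborFinset v := by
    apply eq_of_subset_of_card_le
    · intro u hu
      simp only [mem_insert, mem_singleton] at hu
      rw [SimpleGraph.mem_neighborFinset]
      rcases hu with rfl | rfl | rfl <;> assumption
    · rw [SimpleGraph.card_neighborFinset_eq_degree, card_eq_three.2 ⟨x, y, z, hxy, hxz, hyz, rfl⟩]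
      exact hv
  have := (G.mem_neighborFinset v w).2 hw
  rw [← h] at this
  simpa using this

/-- With degrees at most three, no edge outside the K₄ meets it, so its six edges can be colored
independently of the rest of `S`. -/
theorem exists_isColoringOn_of_complete_four [Fintype V] [DecidableRel G.Adj]
    [DecidableEq G.edgeSet] (hg : ∀ x y, g y x = -g x y) (hL : ∀ e, (L e).card = 4)
    (hdeg : ∀ v, G.degree v ≤ 3) {a b c d : V} (hab : G.Adj a b) (hac : G.Adj a c)
    (had : G.Adj a d) (hbc : G.Adj b c) (hbd : G.Adj b d) (hcd : G.Adj c d)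
    (hS : (⟨s(a, b), hab⟩ : G.edgeSet) ∈ S)
    (ih : ∀ T ⊂ S, ∃ φ, IsColoringOn G.lineGraph g L T φ) :
    ∃ φ, IsColoringOn G.lineGraph g L S φ := by
  have nab := hab.ne
  have nac := hac.ne
  have nad := had.ne
  have nbc := hbc.ne
  have nbd := hbd.ne
  have ncd := hcd.ne
  have hNa := fun w => eq_of_adj_of_degree_le_three (w := w) (hdeg a) hab hac had nbc nbd ncd
  have hNb := fun w =>
    eq_of_adj_of_degree_le_three (w := w) (hdeg b) hab.symm hbc hbd nac nad ncd
  have hNc := fun w =>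
    eq_of_adj_of_degree_le_three (w := w) (hdeg c) hac.symm hbc.symm hcd nab nad nbd
  have hNd := fun w =>
    eq_of_adj_of_degree_le_three (w := w) (hdeg d) had.symm hbd.symm hcd.symm nab nac nbc
  let K : List G.edgeSet := [⟨s(a, c), hac⟩, ⟨s(b, c), hbc⟩, ⟨s(a, d), had⟩, ⟨s(b, d), hbd⟩,
    ⟨s(c, d), hcd⟩, ⟨s(a, b), hab⟩]
  have hK : ∀ z, (z = a ∨ z = b ∨ z = c ∨ z = d) → ∀ u : G.edgeSet, z ∈ u.1 → u ∈ K := by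
    rintro z hz ⟨u, hu⟩ hzu
    obtain ⟨w, rfl⟩ := Sym2.mem_iff_exists.1 hzu
    have hw : G.Adj z w := hu
    simp only [K, List.mem_cons, List.not_mem_nil, or_false, Subtype.ext_iff]
    rcases hz with rfl | rfl | rfl | rfl
    · rcases hNa w hw with rfl | rfl | rfl <;> simp
    · rcases hNb w hw with rfl | rfl | rfl <;> simp
    · rcases hNc w hw with rfl | rfl | rfl <;> simp
    · rcases hNd w hw with rfl | rfl | rfl <;> simp
  have hKends : ∀ e ∈ K, ∀ z ∈ e.1, z = a ∨ z = b ∨ z = c ∨ z = d := by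
    intro e he z hz
    simp only [K, List.mem_cons, List.not_mem_nil, or_false] at he
    rcases he with rfl | rfl | rfl | rfl | rfl | rfl <;>
      rcases Sym2.mem_iff.1 hz with rfl | rfl <;> simp
  obtain ⟨φ, hφ⟩ := ih (S.filter (· ∉ K)) (filter_ssubset.2 ⟨_, hS, by simp [K]⟩)
  -- Opposite edges of the K₄ are the antipodal pairs of the octahedron.
  obtain ⟨ψ, hψ⟩ := hφ.exists_insert_octahedron hg hL
    (a := ⟨s(a, b), hab⟩) (b := ⟨s(c, d), hcd⟩) (c := ⟨s(a, c), hac⟩) (d := ⟨s(b, d), hbd⟩)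
    (e := ⟨s(a, d), had⟩) (f := ⟨s(b, c), hbc⟩)
    (by simp [Subtype.ext_iff, nab, nac, nad, nbc, nbd, ncd, nab.symm, nac.symm, nad.symm,
      nbc.symm, nbd.symm, ncd.symm])
    (by simp [SimpleGraph.lineGraph_adj_iff_exists, nac.symm, nad.symm, nbc.symm, nbd.symm])
    (by simp [SimpleGraph.lineGraph_adj_iff_exists, nab, nad, nbc.symm, ncd])
    (by simp [SimpleGraph.lineGraph_adj_iff_exists, nab.symm, nbd, nac.symm, ncd])
    (by
      intro x hx
      refine ⟨fun h => (mem_filter.1 h).2 hx, fun u hu hxu => ?_⟩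
      obtain ⟨-, z, hz, hz'⟩ := SimpleGraph.lineGraph_adj_iff_exists.1 hxu
      exact (mem_filter.1 hu).2 (hK z (hKends x hx z hz) u hz'))
  refine ⟨ψ, hψ.mono fun x hx => ?_⟩
  by_cases h : x ∈ K
  · simp only [mem_insert]
    simp only [K, List.mem_cons, List.not_mem_nil, or_false] at h
    tauto
  · simp only [mem_insert, mem_filter]
    tauto

theorem exists_isColoringOn_lineGraph [Fintype V] [DecidableRel G.Adj]
    (hM : ¬ IsMinor nearOuterplanarObstruction G) (hg : ∀ x y, g y x = -g x y)
    (hL : ∀ e, (L e).card = G.maxDegree + 1) (S : Finset G.edgeSet) :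
    ∃ c, IsColoringOn G.lineGraph g L S c := by
  classical
  induction S using Finset.strongInduction with
  | H S ih =>
  rcases S.eq_empty_or_nonempty with rfl | ⟨⟨e, he⟩, heS⟩
  · exact ⟨0, by simp [IsColoringOn]⟩
  induction e with | _ x y =>
  have hxy : (edgeSubgraph S).Adj x y := ⟨he, heS⟩
  by_cases hdeg : ∀ v w, (edgeSubgraph S).Adj v w →
      ∀ s t, ∃ u, (edgeSubgraph S).Adj v u ∧ u ≠ s ∧ u ≠ t
  · obtain ⟨a, b, c, d, ⟨hab, hac, had, hbc, hbd, hcd⟩, ha, hb⟩ :=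
      exists_complete_four_of_not_isMinor (fun h => hM (h.mono edgeSubgraph_le)) hxy hdeg
    have hΔ : 3 ≤ G.maxDegree := by
      refine le_trans ?_ (G.degree_le_maxDegree a)
      rw [← G.card_neighborFinset_eq_degree,
        ← card_eq_three.2 ⟨b, c, d, hbc.ne, hbd.ne, hcd.ne, rfl⟩]
      apply card_le_card
      intro u hu
      simp only [mem_insert, mem_singleton] at hu
      rw [SimpleGraph.mem_neighborFinset]
      rcases hu with rfl | rfl | rfl
      · exact hab.1
      · exact hac.1
      · exact had.1
    rcases hΔ.eq_or_lt with hΔ | hΔ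
    · exact exists_isColoringOn_of_complete_four hg (fun e => by rw [hL, ← hΔ])
        (fun v => hΔ ▸ G.degree_le_maxDegree v) hab.1 hac.1 had.1 hbc.1 hbd.1 hcd.1 hab.2 ih
    · refine exists_isColoringOn_of_erase hg hab.2 (ih _ (erase_ssubset hab.2))
        {s(a, c), s(a, d), s(b, c), s(b, d)} (card_le_four.trans_lt (by rw [hL]; omega)) ?_
      intro u hu hne z hz hz'
      obtain ⟨w, hw, e⟩ := exists_edgeSubgraph_adj hu hz'
      have hne' : u.1 ≠ s(a, b) := fun h => hne (Subtype.ext h)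
      rw [e] at hne' ⊢
      rcases Sym2.mem_iff.1 hz with rfl | rfl
      · rcases ha w hw with rfl | rfl | rfl
        · exact absurd rfl hne'
        · simp
        · simp
      · rcases hb w hw with rfl | rfl | rfl
        · exact absurd Sym2.eq_swap hne'
        · simp
        · simp
  · push Not at hdeg
    obtain ⟨v, w, hvw, s, t, hst⟩ := hdeg
    -- All neighbors of `v` along `S`, including `w`, are among `s`, `t`. So besides `vw` there are
    -- at most Δ - 1 edges at `w` and one edge of `S` at `v`.
    refine exists_isColoringOn_of_erase hg hvw.2 (ih _ (erase_ssubset hvw.2))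
      ((G.incidenceFinset w).erase s(v, w) ∪ ({s(v, s), s(v, t)} : Finset _).erase s(v, w)) ?_ ?_
    · have h1 : ((G.incidenceFinset w).erase s(v, w)).card = G.degree w - 1 := by
        rw [card_erase_of_mem, G.card_incidenceFinset_eq_degree]
        rw [SimpleGraph.mem_incidenceFinset]
        exact ⟨hvw.1, Sym2.mem_mk_right _ _⟩
      have h2 : (({s(v, s), s(v, t)} : Finset _).erase s(v, w)).card ≤ 1 := by
        rw [card_erase_of_mem]
        · have := card_le_two (a := s(v, s)) (b := s(v, t))
          omega
        · by_cases h : w = s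
          · simp [h]
          · simp [hst w hvw h]
      have h3 := G.degree_le_maxDegree w
      have h4 : 0 < G.degree w := (G.degree_pos_iff_exists_adj w).2 ⟨v, hvw.1.symm⟩
      have h5 := card_union_le ((G.incidenceFinset w).erase s(v, w))
        (({s(v, s), s(v, t)} : Finset _).erase s(v, w))
      rw [hL]
      omega
    · intro u hu hne z hz hz'
      have hne' : u.1 ≠ s(v, w) := fun h => hne (Subtype.ext h)
      rcases Sym2.mem_iff.1 hz with rfl | rfl
      · obtain ⟨r, hr, e⟩ := exists_edgeSubgraph_adj hu hz'
        refine mem_union_right _ (mem_erase.2 ⟨hne', ?_⟩)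
        rw [e]
        by_cases h : r = s
        · simp [h]
        · simp [hst r hr h]
      · refine mem_union_left _ (mem_erase.2 ⟨hne', ?_⟩)
        rw [SimpleGraph.mem_incidenceFinset]
        exact ⟨u.2, hz'⟩

theorem isEdgeGroupChoosable_of_not_isMinor {V : Type u} [Fintype V] (G : SimpleGraph V)
    [DecidableRel G.Adj] (hM : ¬ IsMinor nearOuterplanarObstruction G) :
    IsEdgeGroupChoosable.{u, w} G (G.maxDegree + 1) := by
  classical
  intro A _ _ L hL D hD f
  -- The antisymmetric form of `f` makes the conflict condition independent of direction; the value
  -- 0 occurs only on nonadjacent pairs.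
  let g : G.edgeSet → G.edgeSet → A := fun x y =>
    if h : D x y then f ⟨s(x, y), G.lineGraph.mem_edgeSet.2 (hD.adj h)⟩
    else if h : D y x then -f ⟨s(y, x), G.lineGraph.mem_edgeSet.2 (hD.adj h)⟩ else 0
  have hg : ∀ x y, g y x = -g x y := by
    intro x y
    by_cases h : D x y
    · simp [g, h, hD.asymm h]
    · by_cases h' : D y x <;> simp [g, h, h']
  obtain ⟨c, hc⟩ := exists_isColoringOn_lineGraph hM hg hL univ
  refine ⟨c, fun v => (hc v (mem_univ v)).1, fun x y h => ?_⟩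
  have := (hc x (mem_univ x)).2 y (mem_univ y) (hD.adj h)
  simpa [g, h] using this

end EdgeColoring

end GroupChoosability

theorem mainTheorem2 {V : Type u} [Fintype V] (G : SimpleGraph V) [DecidableRel G.Adj] :
    (¬ GroupChoosability.IsMinor GroupChoosability.nearOuterplanarObstruction G →
      GroupChoosability.groupChoiceIndex.{u, w} G ≤ ((G.maxDegree + 1 : ℕ) : ℕ∞)) ∧
    (¬ GroupChoosability.IsMinor (completeBipartiteGraph (Fin 2) (Fin 3)) G →
      GroupChoosability.IsEdgeGroupChoosable.{u, w} G (G.maxDegree + 1)) := by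
  refine ⟨fun h => ?_, fun h => ?_⟩
  · exact iInf₂_le (G.maxDegree + 1) (GroupChoosability.isEdgeGroupChoosable_of_not_isMinor G h)
  · exact GroupChoosability.isEdgeGroupChoosable_of_not_isMinor G fun h' =>
      h (GroupChoosability.isMinor_completeBipartiteGraph_of_isMinor_obstruction h')
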